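/- Let $k$ be an algebraically closed field, let $n, d$ be positive integers with $d \le n$, let $M \cong \mathbb{Z}^n$ be a lattice, $N = \mathrm{Hom}(M,\mathbb{Z})$, $N_{\mathbb{R}} = N \otimes \mathbb{R}$, and let $T = \mathrm{Spec}(k[M])$ be the torus with characters $\chi^u$, $u \in M$. A cone in $N$ is a pointed rational polyhedral cone in $N_{\mathbb{R}}$, a fan in $N$ is a finite nonempty fan of such cones, and a fan is unimodular if each of its cones is generated by part of a $\mathbb{Z}$-basis of $N$. For a fan $\Delta$ in $N$, let $Y(\Delta)$ be its toric variety. For $w \in N_{\mathbb{R}}$ and $f = \sum_v a_v \chi^v \in k[M]$, let $\mathrm{in}_w f$ be the sum of those terms $a_v\chi^v$, $a_v \neq 0$, for which $\langle v, w\rangle$ is minimal, and let $\mathrm{supp}$ denote the set of exponents occurring with nonzero coefficient; for a closed subscheme $X \subset T$ with ideal $I$, let $\mathrm{in}_w X \subset T$ be defined by the ideal generated by all $\mathrm{in}_w f$, $f \in I$. A fan $\Delta$ is a tropical fan for a reduced closed subscheme $X \subset T$ of pure dimension $d$ if the closure $X^\Delta$ of $X$ in $Y(\Delta)$ is complete and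 the multiplication map $T \times_k X^\Delta \to Y(\Delta)$ is faithfully flat. Let $f_1, \dots, f_{n-d} \in k[M]$, let $\Delta, \overline{\Delta}$ be fans in $N$, let $\sigma \in \overline{\Delta}$, and let $X \subset T$ be the closed subscheme defined by the ideal $(f_1, \dots, f_{n-d})$. Suppose that (i) $X$ is reduced and of pure dimension $d$; (ii) $\Delta \subset \overline{\Delta}$; (iii) $\overline{\Delta}$ is unimodular; (iv) $\Delta$ is a tropical fan for $X \subset T$; (v) for each face $\tau$ of $\sigma$, all $w_1, w_2 \in \mathrm{relint}(\tau)$ and each $i$, $\mathrm{in}_{w_1} f_i = \mathrm{in}_{w_2} f_i$; (vi) for each $w \in \sigma$, $\mathrm{in}_w f_1, \dots, \mathrm{in}_w f_{n-d}$ generate the ideal of $\mathrm{in}_w X$ in $k[M]$. Let $Y(\sigma) = \mathrm{Spec}(k[\sigma^\vee \cap M])$ and let $X^\sigma \subset Y(\sigma)$ be the closure of $X$. Then for each $i$ and each $v \in M$, one has $v \in \mathrm{supp}(\mathrm{in}_w f_i)$ for all $w \in \mathrm{relint}(\sigma)$ if and only if this holds for some $w \in \mathrm{relint}(\sigma)$.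 Moreover, if $u_1, \dots, u_{n-d} \in M$ are such that for each $i$, $-u_i \in \mathrm{supp}(\mathrm{in}_w f_i)$ for all (equivalently, some) $w \in \mathrm{relint}(\sigma)$, then $\chi^{u_1} f_1, \dots, \chi^{u_{n-d}} f_{n-d}$ lie in $k[\sigma^\vee \cap M]$ and generate the ideal of $X^\sigma$ in $k[\sigma^\vee \cap M]$. -/

import Mathlib

universe u

noncomputable section

namespace Toric

open AlgebraicGeometry CategoryTheory Limits TensorProduct

/-- The real vector space `N_ℝ = N ⊗ ℝ`, for `N = Hom(M, ℤ)`, in its canonical form `Hom(M, ℝ)`; the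
pairing of `u : M` with `w : N_ℝ` is `w u`. -/
abbrev NReal (M : Type u) [AddCommGroup M] : Type u := M →ₗ[ℤ] ℝ

variable {M : Type u} [AddCommGroup M]

/-- For a lattice `M`, the topology of pointwise convergence is the Euclidean topology of the
finite-dimensional space `N_ℝ`. -/
instance : TopologicalSpace (NReal M) :=
  TopologicalSpace.induced (fun (w : NReal M) (u : M) => w u) inferInstance

/-- The embedding `N = Hom(M, ℤ) → N_ℝ`. -/
def latticeVector (v : M →ₗ[ℤ] ℤ) : NReal M :=
  (Int.castAddHom ℝ).toIntLinearMap ∘ₗ v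

/-- The relative interior of a cone. -/
def relint (σ : PointedCone ℝ (NReal M)) : Set (NReal M) :=
  intrinsicInterior ℝ (σ : Set (NReal M))

/-- The monoid `σ^∨ ∩ M`. -/
def dualMonoid (σ : PointedCone ℝ (NReal M)) : AddSubmonoid M where
  carrier := {u | ∀ w ∈ σ, 0 ≤ w u}
  zero_mem' w _ := by simp
  add_mem' hu hv w hw := by simpa using add_nonneg (hu w hw) (hv w hw)

/-- A cone in `N`: a rational polyhedral cone (generated by finitely many elements of `N`) that is
pointed, i.e. contains no line. -/
structure IsCone (σ : PointedCone ℝ (NReal M)) : Prop where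
  rational : ∃ s : Finset (M →ₗ[ℤ] ℤ), σ = PointedCone.hull ℝ (latticeVector '' (s : Set (M →ₗ[ℤ] ℤ)))
  pointed : (σ : ConvexCone ℝ (NReal M)).Salient

/-- `τ` is a face of `σ`: `τ = σ ∩ m^⊥` for some `m ∈ σ^∨ ∩ M`. (For a rational polyhedral cone each
supporting hyperplane section is cut out by an integral `m`.) -/
def IsFace (τ σ : PointedCone ℝ (NReal M)) : Prop :=
  ∃ m ∈ dualMonoid σ, ∀ w, w ∈ τ ↔ w ∈ σ ∧ w m = 0

theorem dualMonoid_anti {τ σ : PointedCone ℝ (NReal M)} (h : τ ≤ σ) :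
    dualMonoid σ ≤ dualMonoid τ := fun _ hu w hw => hu w (h hw)

variable (k : Type u) [Field k]

/-- The ring `k[σ^∨ ∩ M]`. -/
abbrev CoordRing (σ : PointedCone ℝ (NReal M)) : Type u := AddMonoidAlgebra k (dualMonoid σ)

/-- The inclusion `k[σ^∨ ∩ M] → k[M]`. -/
def incl (σ : PointedCone ℝ (NReal M)) : CoordRing k σ →ₐ[k] AddMonoidAlgebra k M :=
  AddMonoidAlgebra.mapDomainAlgHom k k (dualMonoid σ).subtype

/-- The inclusion `k[σ^∨ ∩ M] → k[τ^∨ ∩ M]` for `τ ⊆ σ`. -/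
def restrict {τ σ : PointedCone ℝ (NReal M)} (h : τ ≤ σ) : CoordRing k σ →ₐ[k] CoordRing k τ :=
  AddMonoidAlgebra.mapDomainAlgHom k k (AddSubmonoid.inclusion (dualMonoid_anti h))

theorem restrict_injective {τ σ : PointedCone ℝ (NReal M)} (h : τ ≤ σ) :
    Function.Injective (restrict k h) :=
  AddMonoidAlgebra.mapDomain_injective (AddSubmonoid.inclusion_injective _)

theorem exists_add_nsmul_mem {τ σ : PointedCone ℝ (NReal M)} (hσ : IsCone σ) {m : M}
    (hm : m ∈ dualMonoid σ) (hτ : ∀ w, w ∈ τ ↔ w ∈ σ ∧ w m = 0) {u : M}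
    (hu : u ∈ dualMonoid τ) : ∃ c : ℕ, ∀ c' ≥ c, u + c' • m ∈ dualMonoid σ := by
  classical
  obtain ⟨s, rfl⟩ := hσ.rational
  have key : ∀ v ∈ s, ∃ c : ℕ, ∀ c' ≥ c, 0 ≤ latticeVector v (u + c' • m) := by
    intro v hv
    have hvσ : latticeVector v ∈ PointedCone.hull ℝ (latticeVector '' (s : Set (M →ₗ[ℤ] ℤ))) :=
      Submodule.subset_span ⟨v, hv, rfl⟩
    have h0 := hm _ hvσ
    rcases h0.eq_or_lt with h | h
    · refine ⟨0, fun c' _ => ?_⟩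
      have := hu _ ((hτ _).2 ⟨hvσ, h.symm⟩)
      simpa [← h] using this
    · obtain ⟨c, hc⟩ := exists_nat_gt (-(latticeVector v u) / latticeVector v m)
      refine ⟨c, fun c' hc' => ?_⟩
      rw [div_lt_iff₀ h] at hc
      have : (c : ℝ) ≤ c' := by exact_mod_cast hc'
      simp only [map_add, map_nsmul, nsmul_eq_mul]
      nlinarith
  choose! c hc using key
  refine ⟨s.sup c, fun c' hc' => ?_⟩
  intro w hw
  induction hw using Submodule.span_induction with
  | mem x hx =>
    obtain ⟨v, hv, rfl⟩ := hx
    exact hc v hv c' (le_trans (Finset.le_sup hv) hc')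
  | zero => simp
  | add x y _ _ hx hy => simpa using add_nonneg hx hy
  | smul a x _ hx =>
    have := mul_nonneg a.2 hx
    exact this

theorem isLocalization_restrict {τ σ : PointedCone ℝ (NReal M)} (hσ : IsCone σ) (h : τ ≤ σ)
    {m : M} (hm : m ∈ dualMonoid σ) (hτ : ∀ w, w ∈ τ ↔ w ∈ σ ∧ w m = 0) :
    letI := (restrict k h).toRingHom.toAlgebra
    IsLocalization.Away (AddMonoidAlgebra.single (⟨m, hm⟩ : dualMonoid σ) (1 : k))
      (CoordRing k τ) := by
  let := (restrict k h).toRingHom.toAlgebra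
  have halg : ∀ x, algebraMap (CoordRing k σ) (CoordRing k τ) x = restrict k h x := fun _ => rfl
  have hsing : ∀ (a : dualMonoid σ) (r : k), restrict k h (AddMonoidAlgebra.single a r) =
      AddMonoidAlgebra.single (AddSubmonoid.inclusion (dualMonoid_anti h) a) r := by
    intro a r
    exact AddMonoidAlgebra.mapDomain_single
  refine IsLocalization.Away.mk _ ?_ ?_ ?_
  · have hneg : -m ∈ dualMonoid τ := fun w hw => by simp [((hτ w).1 hw).2]
    refine IsUnit.of_mul_eq_one (AddMonoidAlgebra.single ⟨-m, hneg⟩ 1) ?_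
    rw [halg, hsing, AddMonoidAlgebra.single_mul_single, AddMonoidAlgebra.one_def]
    congr 1
    · ext; simp
    · simp
  · intro g
    suffices H : ∃ c : ℕ, ∀ c' ≥ c, ∃ a, (restrict k h (AddMonoidAlgebra.single (⟨m, hm⟩ : dualMonoid σ) (1 : k))) ^ c' * g = restrict k h a by
      obtain ⟨c, hc⟩ := H
      obtain ⟨a, ha⟩ := hc c le_rfl
      exact ⟨c, a, by rw [halg, halg, mul_comm, ha]⟩
    induction g using AddMonoidAlgebra.induction_linear with
    | zero => exact ⟨0, fun _ _ => ⟨0, by simp⟩⟩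
    | add f g hf hg =>
      obtain ⟨c, hc⟩ := hf
      obtain ⟨d, hd⟩ := hg
      refine ⟨max c d, fun c' h' => ?_⟩
      obtain ⟨a, ha⟩ := hc c' (le_trans (le_max_left _ _) h')
      obtain ⟨b, hb⟩ := hd c' (le_trans (le_max_right _ _) h')
      exact ⟨a + b, by rw [mul_add, ha, hb, map_add]⟩
    | single v r =>
      obtain ⟨c, hc⟩ := exists_add_nsmul_mem hσ hm hτ v.2
      refine ⟨c, fun c' h' => ⟨AddMonoidAlgebra.single ⟨_, hc c' h'⟩ r, ?_⟩⟩
      rw [hsing, hsing, AddMonoidAlgebra.single_pow, AddMonoidAlgebra.single_mul_single]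
      congr 1
      · ext; simp [add_comm]
      · simp
  · intro a b hab
    exact ⟨0, by rw [restrict_injective k h hab]⟩


variable (M) in
/-- A fan in `N`: a finite nonempty collection of cones in `N`, closed under taking faces, any two of
which meet in a face of each. (Nonempty is stated as `{0} ∈ Δ`, as `{0}` is a face of each cone.) -/
structure Fan where
  cones : Set (PointedCone ℝ (NReal M))
  finite : cones.Finite
  bot_mem : ⊥ ∈ cones
  isCone : ∀ σ ∈ cones, IsCone σ
  face_mem : ∀ σ ∈ cones, ∀ τ, IsFace τ σ → τ ∈ cones
  inf_isFace : ∀ σ ∈ cones, ∀ τ ∈ cones, IsFace (σ ⊓ τ) σ ∧ IsFace (σ ⊓ τ) τ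

/-- A unimodular cone: one generated by part of a `ℤ`-basis of `N`. -/
def IsUnimodular (σ : PointedCone ℝ (NReal M)) : Prop :=
  ∃ (b : Module.Basis (Fin (Module.finrank ℤ M)) ℤ (M →ₗ[ℤ] ℤ)) (s : Set (Fin (Module.finrank ℤ M))),
    σ = PointedCone.hull ℝ ((fun i => latticeVector (b i)) '' s)

namespace Fan

theorem isFace_of_le (Δ : Fan M) {τ σ : PointedCone ℝ (NReal M)} (hτ : τ ∈ Δ.cones)
    (hσ : σ ∈ Δ.cones) (h : τ ≤ σ) : IsFace τ σ := by
  have := (Δ.inf_isFace σ hσ τ hτ).1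
  rwa [inf_eq_right.2 h] at this

variable (Δ : Fan M)

/-- The affine toric variety `Y(σ) = Spec k[σ^∨ ∩ M]`. -/
abbrev chart (σ : PointedCone ℝ (NReal M)) : Scheme.{u} := Spec (.of (CoordRing k σ))

/-- The morphism `Y(τ) → Y(σ)` for `τ ⊆ σ`. -/
def chartMap {τ σ : PointedCone ℝ (NReal M)} (h : τ ≤ σ) : chart k τ ⟶ chart k σ :=
  Spec.map (CommRingCat.ofHom (restrict k h).toRingHom)

/-- The diagram of the `Y(σ)`, `σ ∈ Δ`, with the open immersions `Y(τ) → Y(σ)` for `τ ⊆ σ`. -/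
def diagram : Δ.cones ⥤ Scheme.{u} where
  obj σ := chart k σ.1
  map f := chartMap k (leOfHom f)
  map_id σ := by
    rw [chartMap, ← Spec.map_id]
    congr 1
    ext : 1
    exact congrArg AlgHom.toRingHom (AddMonoidAlgebra.mapDomainAlgHom_id (R := k) (A := k))
  map_comp f g := by
    rw [chartMap, chartMap, chartMap, ← Spec.map_comp]
    congr 1
    ext : 1
    exact congrArg AlgHom.toRingHom (AddMonoidAlgebra.mapDomainAlgHom_comp (R := k) (A := k)
      (AddSubmonoid.inclusion (dualMonoid_anti (leOfHom g)))
      (AddSubmonoid.inclusion (dualMonoid_anti (leOfHom f))))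

instance instIsOpenImmersionMap {σ τ : Δ.cones} (f : σ ⟶ τ) : IsOpenImmersion ((Δ.diagram k).map f) := by
  obtain ⟨m, hm, h⟩ := Δ.isFace_of_le σ.2 τ.2 (leOfHom f)
  let := (restrict k (leOfHom f)).toRingHom.toAlgebra
  have := isLocalization_restrict k (Δ.isCone _ τ.2) (leOfHom f) hm h
  exact IsOpenImmersion.of_isLocalization
    (AddMonoidAlgebra.single (⟨m, hm⟩ : dualMonoid τ.1) (1 : k))

theorem range_diagram_map {σ τ : Δ.cones} (f : σ ⟶ τ) {m : M} (hm : m ∈ dualMonoid τ.1)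
    (h : ∀ w, w ∈ σ.1 ↔ w ∈ τ.1 ∧ w m = 0) :
    Set.range ((Δ.diagram k).map f) = (PrimeSpectrum.basicOpen
      (AddMonoidAlgebra.single (⟨m, hm⟩ : dualMonoid τ.1) (1 : k)) :
        Set (PrimeSpectrum (CoordRing k τ.1))) := by
  let := (restrict k (leOfHom f)).toRingHom.toAlgebra
  have := isLocalization_restrict k (Δ.isCone _ τ.2) (leOfHom f) hm h
  exact PrimeSpectrum.localization_away_comap_range (CoordRing k σ.1)
    (AddMonoidAlgebra.single (⟨m, hm⟩ : dualMonoid τ.1) (1 : k))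

instance : (Δ.diagram k ⋙ Scheme.forget).IsLocallyDirected where
  cond {i j l} fi fj xi xj hx := by
    obtain ⟨m, hm, h⟩ := Δ.isFace_of_le i.2 l.2 (leOfHom fi)
    obtain ⟨m', hm', h'⟩ := Δ.isFace_of_le j.2 l.2 (leOfHom fj)
    let e : Δ.cones := ⟨i.1 ⊓ j.1, Δ.face_mem _ i.2 _ (Δ.inf_isFace _ i.2 _ j.2).1⟩
    let gi : e ⟶ i := homOfLE (show i.1 ⊓ j.1 ≤ i.1 from inf_le_left)
    let gj : e ⟶ j := homOfLE (show i.1 ⊓ j.1 ≤ j.1 from inf_le_right)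
    have he : ∀ w, w ∈ e.1 ↔ w ∈ l.1 ∧ w (m + m') = 0 := by
      intro w
      rw [map_add]
      constructor
      · intro hw
        have h1 := (h w).1 hw.1
        have h2 := (h' w).1 hw.2
        exact ⟨h1.1, by rw [h1.2, h2.2, add_zero]⟩
      · rintro ⟨hw, h0⟩
        have h1 := hm w hw
        have h2 := hm' w hw
        exact ⟨(h w).2 ⟨hw, by linarith⟩, (h' w).2 ⟨hw, by linarith⟩⟩
    have hx' : (Δ.diagram k).map fi xi = (Δ.diagram k).map fj xj := hx
    have hr := Δ.range_diagram_map k (gi ≫ fi) (add_mem hm hm') he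
    have hmem : (Δ.diagram k).map fi xi ∈ Set.range ((Δ.diagram k).map (gi ≫ fi)) := by
      rw [hr]
      have h1 : (Δ.diagram k).map fi xi ∈ Set.range ((Δ.diagram k).map fi) := ⟨_, rfl⟩
      have h2 : (Δ.diagram k).map fi xi ∈ Set.range ((Δ.diagram k).map fj) := ⟨_, hx'.symm⟩
      rw [Δ.range_diagram_map k fi hm h] at h1
      rw [Δ.range_diagram_map k fj hm' h'] at h2
      have hs : (AddMonoidAlgebra.single (⟨m + m', add_mem hm hm'⟩ : dualMonoid l.1) (1 : k)) =
          AddMonoidAlgebra.single (⟨m, hm⟩ : dualMonoid l.1) (1 : k) *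
          AddMonoidAlgebra.single (⟨m', hm'⟩ : dualMonoid l.1) (1 : k) := by
        rw [AddMonoidAlgebra.single_mul_single, mul_one]
        rfl
      rw [hs, PrimeSpectrum.basicOpen_mul]
      exact ⟨h1, h2⟩
    obtain ⟨x, hx1⟩ := hmem
    refine ⟨e, gi, gj, x, ?_, ?_⟩
    · apply ((Δ.diagram k).map fi).isOpenEmbedding.injective
      refine Eq.trans ?_ hx1
      rw [Functor.map_comp]
      rfl
    · apply ((Δ.diagram k).map fj).isOpenEmbedding.injective
      rw [← hx', ← hx1, Subsingleton.elim (gi ≫ fi) (gj ≫ fj), Functor.map_comp]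
      rfl

/-- The toric variety `Y(Δ)`: the `Y(σ)`, `σ ∈ Δ`, glued along their common faces. -/
def toricVariety : Scheme.{u} := colimit (Δ.diagram k)

/-- The open immersion `Y(σ) → Y(Δ)`. -/
def chartι (σ : Δ.cones) : chart k σ.1 ⟶ Δ.toricVariety k := colimit.ι (Δ.diagram k) σ

instance (σ : Δ.cones) : IsOpenImmersion (Δ.chartι k σ) :=
  inferInstanceAs (IsOpenImmersion (colimit.ι (Δ.diagram k) σ))

theorem map_chartι {τ σ : Δ.cones} (h : τ.1 ≤ σ.1) :
    chartMap k h ≫ Δ.chartι k σ = Δ.chartι k τ :=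
  colimit.w (Δ.diagram k) (homOfLE (show τ ≤ σ from h))

/-- The structure morphism `Y(σ) → Spec k`. -/
abbrev chartOver (σ : PointedCone ℝ (NReal M)) : chart k σ ⟶ Spec (.of k) :=
  Spec.map (CommRingCat.ofHom (algebraMap k (CoordRing k σ)))

theorem map_chartOver {τ σ : PointedCone ℝ (NReal M)} (h : τ ≤ σ) :
    chartMap k h ≫ chartOver k σ = chartOver k τ := by
  rw [chartMap, ← Spec.map_comp]
  congr 1
  ext : 1
  exact (restrict k h).comp_algebraMap

/-- The structure morphism `Y(Δ) → Spec k`. -/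
def structureMap : Δ.toricVariety k ⟶ Spec (.of k) :=
  colimit.desc (Δ.diagram k)
    { pt := Spec (.of k)
      ι := { app := fun σ => chartOver k σ.1
             naturality := fun σ τ f => by
              exact (map_chartOver k (leOfHom f)).trans (Category.comp_id _).symm } }

theorem chartι_over (σ : Δ.cones) : Δ.chartι k σ ≫ Δ.structureMap k = chartOver k σ.1 :=
  colimit.ι_desc (F := Δ.diagram k) _ _

theorem exists_lift_eq {i j : Δ.cones}
    (x : (pullback (Δ.chartι k i) (Δ.chartι k j) : Scheme.{u})) :
    ∃ (l : Δ.cones) (fi : l ⟶ i) (fj : l ⟶ j) (y : chart k l.1),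
      pullback.lift (chartMap k (leOfHom fi)) (chartMap k (leOfHom fj))
        ((Δ.map_chartι k (leOfHom fi)).trans (Δ.map_chartι k (leOfHom fj)).symm) y = x := by
  have hx : Δ.chartι k i (pullback.fst (Δ.chartι k i) (Δ.chartι k j) x) =
      Δ.chartι k j (pullback.snd (Δ.chartι k i) (Δ.chartι k j) x) := by
    rw [← Scheme.Hom.comp_apply, ← Scheme.Hom.comp_apply, pullback.condition]
  obtain ⟨l, fi, fj, y, h1, h2⟩ := (Scheme.IsLocallyDirected.ι_eq_ι_iff (Δ.diagram k)).1 hx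
  refine ⟨l, fi, fj, y, ?_⟩
  apply (pullback.fst (Δ.chartι k i) (Δ.chartι k j)).isOpenEmbedding.injective
  refine Eq.trans ?_ h1
  exact congrArg (fun g : chart k l.1 ⟶ chart k i.1 => g y) (pullback.lift_fst _ _ _)

/-- The open cover of `Y(Δ)` by the `Y(σ)`. -/
def cover : (Δ.toricVariety k).OpenCover := Scheme.IsLocallyDirected.openCover (Δ.diagram k)

instance : Category (Δ.cover k).I₀ := inferInstanceAs (Category Δ.cones)

instance : (Δ.cover k).LocallyDirected where
  trans f := (Δ.diagram k).map f
  trans_id i := (Δ.diagram k).map_id i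
  trans_comp f g := (Δ.diagram k).map_comp f g
  w f := Δ.map_chartι k (leOfHom f)
  directed x := Δ.exists_lift_eq k x
  property_trans {i j} f :=
    instIsOpenImmersionMap k Δ (σ := i) (τ := j) f

end Fan

variable (M) in
/-- The torus `T = Spec k[M]`. -/
abbrev torus : Scheme.{u} := Spec (.of (AddMonoidAlgebra k M))

variable (M) in
/-- The structure morphism `T → Spec k`. -/
abbrev torusOver : torus M k ⟶ Spec (.of k) :=
  Spec.map (CommRingCat.ofHom (algebraMap k (AddMonoidAlgebra k M)))

/-- The coaction `χ^u ↦ χ^u ⊗ χ^u` defining the action of `T` on `Y(σ)`. -/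
def coaction (σ : PointedCone ℝ (NReal M)) :
    CoordRing k σ →ₐ[k] AddMonoidAlgebra k M ⊗[k] CoordRing k σ :=
  AddMonoidAlgebra.lift k _ (dualMonoid σ)
    { toFun := fun u => AddMonoidAlgebra.single (u.toAdd : M) 1 ⊗ₜ[k]
        AddMonoidAlgebra.single u.toAdd 1
      map_one' := rfl
      map_mul' := fun u v => by
        rw [Algebra.TensorProduct.tmul_mul_tmul, AddMonoidAlgebra.single_mul_single,
          AddMonoidAlgebra.single_mul_single, mul_one]
        rfl }

theorem coaction_restrict {τ σ : PointedCone ℝ (NReal M)} (h : τ ≤ σ) :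
    (coaction k τ).comp (restrict k h) =
      (Algebra.TensorProduct.map (AlgHom.id k _) (restrict k h)).comp (coaction k σ) := by
  ext u
  simp [coaction, restrict]

/-- The action morphism `T × Y(σ) → Y(σ)`. -/
def chartAct (σ : PointedCone ℝ (NReal M)) :
    pullback (torusOver M k) (Fan.chartOver k σ) ⟶ Fan.chart k σ :=
  (pullbackSpecIso k (AddMonoidAlgebra k M) (CoordRing k σ)).hom ≫
    Spec.map (CommRingCat.ofHom (coaction k σ).toRingHom)

/-- The morphism `T × Y(τ) → T × Y(σ)` for `τ ⊆ σ`. -/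
def prodMap {τ σ : PointedCone ℝ (NReal M)} (h : τ ≤ σ) :
    pullback (torusOver M k) (Fan.chartOver k τ) ⟶ pullback (torusOver M k) (Fan.chartOver k σ) :=
  pullback.lift (pullback.fst (torusOver M k) (Fan.chartOver k τ))
    (pullback.snd (torusOver M k) (Fan.chartOver k τ) ≫ Fan.chartMap k h)
    (by rw [Category.assoc, Fan.map_chartOver, pullback.condition])

theorem chartAct_map {τ σ : PointedCone ℝ (NReal M)} (h : τ ≤ σ) :
    prodMap k h ≫ chartAct k σ = chartAct k τ ≫ Fan.chartMap k h := by
  have h1 : prodMap k h =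
      (pullbackSpecIso k (AddMonoidAlgebra k M) (CoordRing k τ)).hom ≫
      Spec.map (CommRingCat.ofHom (Algebra.TensorProduct.map (AlgHom.id k (AddMonoidAlgebra k M))
        (restrict k h)).toRingHom) ≫
      (pullbackSpecIso k (AddMonoidAlgebra k M) (CoordRing k σ)).inv := by
    rw [prodMap, ← Iso.inv_comp_eq]
    apply pullback.hom_ext
    · rw [Category.assoc, Category.assoc, pullback.lift_fst, pullbackSpecIso_inv_fst,
        pullbackSpecIso_inv_fst, ← Spec.map_comp]
      congr 1
      ext : 1
      exact congrArg AlgHom.toRingHom (Algebra.TensorProduct.map_comp_includeLeft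
        (AlgHom.id k (AddMonoidAlgebra k M)) (restrict k h)).symm
    · rw [Category.assoc, Category.assoc, pullback.lift_snd, pullbackSpecIso_inv_snd,
        ← Category.assoc, pullbackSpecIso_inv_snd, Fan.chartMap, ← Spec.map_comp, ← Spec.map_comp]
      congr 1
  rw [h1, chartAct, chartAct, Fan.chartMap, Category.assoc, Category.assoc, Category.assoc,
    Iso.inv_hom_id_assoc, ← Spec.map_comp, ← Spec.map_comp]
  congr 2
  ext : 1
  exact congrArg AlgHom.toRingHom (coaction_restrict k h).symm

namespace Fan
variable (Δ : Fan M)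

/-- The part of `T × Y(Δ)` over `Y(σ)`, as `T × Y(σ)`. -/
def toChart (σ : Δ.cones) :
    pullback (pullback.snd (torusOver M k) (Δ.structureMap k)) (Δ.chartι k σ) ⟶
      pullback (torusOver M k) (chartOver k σ.1) :=
  pullback.lift
    (pullback.fst (pullback.snd (torusOver M k) (Δ.structureMap k)) (Δ.chartι k σ) ≫
      pullback.fst (torusOver M k) (Δ.structureMap k))
    (pullback.snd (pullback.snd (torusOver M k) (Δ.structureMap k)) (Δ.chartι k σ))
    (by rw [Category.assoc, pullback.condition, ← Category.assoc, pullback.condition,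
          Category.assoc, chartι_over])

theorem toChart_map {τ σ : Δ.cones} (h : τ.1 ≤ σ.1) :
    pullback.map (pullback.snd (torusOver M k) (Δ.structureMap k)) (Δ.chartι k τ)
      (pullback.snd (torusOver M k) (Δ.structureMap k)) (Δ.chartι k σ) (𝟙 _)
      (chartMap k h) (𝟙 _) (by simp)
      (by rw [map_chartι, Category.comp_id]) ≫ Δ.toChart k σ =
    Δ.toChart k τ ≫ prodMap k h := by
  apply pullback.hom_ext
  · rw [Category.assoc, Category.assoc, toChart, toChart, prodMap, pullback.lift_fst,
      pullback.lift_fst, pullback.lift_fst, pullback.lift_fst_assoc, Category.comp_id]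
  · rw [Category.assoc, Category.assoc, toChart, toChart, prodMap, pullback.lift_snd,
      pullback.lift_snd, pullback.lift_snd, pullback.lift_snd_assoc]

theorem toChart_act {τ σ : Δ.cones} (h : τ.1 ≤ σ.1) :
    (Δ.toChart k τ ≫ prodMap k h) ≫ chartAct k σ.1 ≫ Δ.chartι k σ =
      Δ.toChart k τ ≫ chartAct k τ.1 ≫ Δ.chartι k τ := by
  have h1 := Δ.map_chartι k h
  have h2 := chartAct_map k h
  rw [Category.assoc, ← Category.assoc (prodMap k h), h2, Category.assoc, h1]

/-- The action morphism `T × Y(Δ) → Y(Δ)`, glued from the `T × Y(σ) → Y(σ)`. -/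
def act : pullback (torusOver M k) (Δ.structureMap k) ⟶ Δ.toricVariety k :=
  Scheme.OpenCover.glueMorphismsOfLocallyDirected
    ((Δ.cover k).pullback₁ (pullback.snd (torusOver M k) (Δ.structureMap k)))
    (fun σ : Δ.cones => Δ.toChart k σ ≫ chartAct k σ.1 ≫ Δ.chartι k σ)
    (fun {_ σ : Δ.cones} f =>
      (Category.assoc _ _ _).symm.trans
        ((congrArg (· ≫ chartAct k σ.1 ≫ Δ.chartι k σ) (Δ.toChart_map k (leOfHom f))).trans
          (Δ.toChart_act k (leOfHom f))))

end Fan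

variable {k}

/-- The closed subscheme `X` of `T` defined by the ideal `I`. -/
abbrev subscheme (I : Ideal (AddMonoidAlgebra k M)) : Scheme.{u} :=
  Spec (.of (AddMonoidAlgebra k M ⧸ I))

/-- The closed immersion `X → T`. -/
def subschemeι (I : Ideal (AddMonoidAlgebra k M)) : subscheme I ⟶ torus M k :=
  Spec.map (CommRingCat.ofHom (Ideal.Quotient.mk I))

/-- A scheme is of pure dimension `d` if each of its irreducible components has dimension `d`. -/
def IsPureOfDim (X : Scheme.{u}) (d : ℕ) : Prop :=
  ∀ Z ∈ irreducibleComponents X, topologicalKrullDim Z = d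

/-- The initial form `in_w f`: the sum of the terms `a_v χ^v` of `f` for which `⟨v, w⟩` is minimal. -/
def initialForm (w : NReal M) (f : AddMonoidAlgebra k M) : AddMonoidAlgebra k M :=
  open Classical in
  .ofCoeff (f.coeff.filter fun v => ∀ v' ∈ f.coeff.support, w v ≤ w v')

/-- The ideal of the initial degeneration `in_w X`, generated by the initial forms of all elements of
the ideal `I` of `X`. -/
def initialIdeal (w : NReal M) (I : Ideal (AddMonoidAlgebra k M)) : Ideal (AddMonoidAlgebra k M) :=
  Ideal.span (initialForm w '' (I : Set (AddMonoidAlgebra k M)))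

/-- For reduced `X` with ideal `I`, the ideal in `k[σ^∨ ∩ M]` of the closure `X^σ` of `X` in `Y(σ)`. -/
def closureIdeal (σ : PointedCone ℝ (NReal M)) (I : Ideal (AddMonoidAlgebra k M)) :
    Ideal (CoordRing k σ) :=
  PrimeSpectrum.vanishingIdeal
    (closure (PrimeSpectrum.comap (incl k σ).toRingHom ''
      PrimeSpectrum.zeroLocus (I : Set (AddMonoidAlgebra k M))))

namespace Fan

variable (k) in
/-- The inclusion `T → Y(Δ)`, through the chart `Y({0})`. -/
def torusι (Δ : Fan M) : torus M k ⟶ Δ.toricVariety k :=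
  Spec.map (CommRingCat.ofHom (incl k (⊥ : PointedCone ℝ (NReal M))).toRingHom) ≫
    Δ.chartι k ⟨⊥, Δ.bot_mem⟩

variable (Δ : Fan M) (I : Ideal (AddMonoidAlgebra k M))

/-- The ideal sheaf on `Y(Δ)` of the closure of `X`, with its reduced structure. -/
def closureIdealSheaf : (Δ.toricVariety k).IdealSheafData :=
  Scheme.IdealSheafData.vanishingIdeal
    ⟨closure (Set.range (subschemeι I ≫ Δ.torusι k)), isClosed_closure⟩

/-- The closure `X^Δ` of the reduced scheme `X` in `Y(Δ)`. -/
def closureScheme : Scheme.{u} := (Δ.closureIdealSheaf I).subscheme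

/-- The closed immersion `X^Δ → Y(Δ)`. -/
def closureι : Δ.closureScheme I ⟶ Δ.toricVariety k := (Δ.closureIdealSheaf I).subschemeι

/-- The multiplication map `T × X^Δ → Y(Δ)`. -/
def mult : pullback (torusOver M k) (Δ.closureι I ≫ Δ.structureMap k) ⟶ Δ.toricVariety k :=
  pullback.map (torusOver M k) (Δ.closureι I ≫ Δ.structureMap k) (torusOver M k)
    (Δ.structureMap k) (𝟙 _) (Δ.closureι I) (𝟙 _)
    (by rw [Category.comp_id, Category.id_comp]) (by rw [Category.comp_id]) ≫ Δ.act k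

/-- `Δ` is a tropical fan for the reduced closed subscheme `X` of `T` with ideal `I`: `X^Δ` is
complete and `T × X^Δ → Y(Δ)` is faithfully flat. -/
structure IsTropical : Prop where
  complete : IsProper (Δ.closureι I ≫ Δ.structureMap k)
  flat : Flat (Δ.mult I)
  surjective : Surjective (Δ.mult I)

end Fan

end Toric

end

/-! Let `J` be the ideal generated by the translates `g l = χ^{u l} f l`. Minimality of `-u l` on
the relative interior passes to the rays of `σ`, so each `g l` lies in `k[σ^∨ ∩ M]` and has nonzero
constant term. Since `I` is radical, the ideal of the closure is the contraction of `I`.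
Unimodularity gives coordinates `x i`, one for each ray, whose inversion recovers `k[M]`; the
contraction is therefore the saturation of `J` by `∏ x i`, and it must be shown that `J` is already
saturated.

For a set `S` of rays with complement `S'`, let `J_S = J + (x i : i ∈ S)`. By induction on the size
of `S'`, each `J_S` is saturated by `∏_{S'} x i`. If every element of a saturation `K` of `J_S` lies
in `J_S + (x j)` for each `j ∈ S'`, then `K ⊆ J_S + x j K`; iterating over all `j` gives `K ⊆ J_S +
X ^ N K = J_S` for large `N` (`mem_of_prod_pow_mul_mem`). So it suffices to pass from the saturation
for `S` to that for `S ∪ {j}` (`mem_of_prod_pow_mul_mem_of_insert`).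

This passage, `exists_pow_mul_mem_insert`, is where initial ideals enter. Write `X ^ N * h = q + p`
with `q ∈ J` and `p ∈ (x i : i ∈ S)`. For the weight `w = (N + 1) ∑_{i ∈ S} e i + e j` in `σ`, the
initial form of `q` is `X ^ N * h₀`, where `h₀` is the part of `h` free of the coordinates in `S ∪
{j}` (if `h₀ ≠ 0`). It lies in the initial ideal, which is generated by translates of the
corresponding parts of the `g l`. Cancelling `x j ^ N` and clearing denominators brings the relation
back to the coordinate ring, modulo the coordinates in `S ∪ {j}`. -/

noncomputable section

namespace Toric

/-! ### Saturation criteria in a Noetherian ring -/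

section Saturation

variable {A ι : Type*} [CommRing A] [IsNoetherianRing A]

/-- If each element of the saturation `K` of `J` by `∏ x i` lies in `J + (x i)`, for all `i`, then
`J` is saturated. -/
theorem mem_of_prod_pow_mul_mem (x : ι → A) (J : Ideal A) (T : Finset ι)
    (H : ∀ i ∈ T, ∀ h, (∃ N : ℕ, (∏ i ∈ T, x i) ^ N * h ∈ J) → h ∈ J ⊔ Ideal.span {x i})
    {h : A} (hh : ∃ N : ℕ, (∏ i ∈ T, x i) ^ N * h ∈ J) : h ∈ J := by
  classical
  set X := ∏ i ∈ T, x i with hX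
  -- The colon ideals `(J : X ^ N)` form an ascending chain; its stable member is the whole
  -- saturation.
  let C : ℕ →o Ideal A :=
    { toFun := fun N => Submodule.comap (LinearMap.mulLeft A (X ^ N)) J
      monotone' := monotone_nat_of_le_succ fun N a ha => by
        have : X ^ N * a ∈ J := ha
        change X ^ (N + 1) * a ∈ J
        rw [pow_succ', mul_assoc]
        exact J.mul_mem_left _ this }
  have hC : ∀ N a, a ∈ C N ↔ X ^ N * a ∈ J := fun _ _ => Iff.rfl
  obtain ⟨N, hN⟩ := monotone_stabilizes_iff_noetherian.2 ‹IsNoetherianRing A› C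
  have hK : ∀ a, (∃ n : ℕ, X ^ n * a ∈ J) → a ∈ C N := by
    rintro a ⟨n, hn⟩
    rcases le_total n N with h | h
    · exact C.monotone h ((hC _ _).2 hn)
    · rw [hN n h]; exact (hC _ _).2 hn
  have hJ : J ≤ C N := fun a ha => (hC _ _).2 (J.mul_mem_left _ ha)
  -- With `K = C N` the saturation, the `y` satisfying `K ⊆ J + y K` are closed under products:
  -- substitute one inclusion into the other.
  let D : Submonoid A :=
    { carrier := {y | C N ≤ J ⊔ Ideal.span {y} * C N}
      one_mem' := by simp
      mul_mem' := by
        intro y z hy hz a ha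
        obtain ⟨b, hb, c, hc, rfl⟩ := Submodule.mem_sup.1 (hy ha)
        obtain ⟨c, hcN, rfl⟩ := Ideal.mem_span_singleton_mul.1 hc
        obtain ⟨b', hb', c', hc', rfl⟩ := Submodule.mem_sup.1 (hz hcN)
        obtain ⟨c', hcN', rfl⟩ := Ideal.mem_span_singleton_mul.1 hc'
        refine Submodule.mem_sup.2 ⟨b + y * b', J.add_mem hb (J.mul_mem_left _ hb'), y * z * c',
          Ideal.mem_span_singleton_mul.2 ⟨c', hcN', rfl⟩, by ring⟩ }
  have hD : ∀ i ∈ T, x i ∈ D := by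
    intro i hi a ha
    obtain ⟨b, hb, c, hc, rfl⟩ := Submodule.mem_sup.1 (H i hi a ⟨N, ha⟩)
    obtain ⟨c, rfl⟩ := Ideal.mem_span_singleton.1 hc
    refine Submodule.mem_sup.2 ⟨b, hb, x i * c, Ideal.mem_span_singleton_mul.2 ⟨c, ?_, rfl⟩, rfl⟩
    -- The cofactor `c` is itself in the saturation, because `x i` divides `X`: one more power of
    -- `X` absorbs it.
    have h1 : x i * c ∈ C N := by
      simpa using (C N).sub_mem ha (hJ hb)
    refine hK c ⟨N + 1, ?_⟩
    have h2 : X = (∏ l ∈ T.erase i, x l) * x i := (Finset.prod_erase_mul _ _ hi).symm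
    have h3 : X ^ (N + 1) * c = (∏ l ∈ T.erase i, x l) * (X ^ N * (x i * c)) := by
      rw [pow_succ]
      nth_rewrite 2 [h2]
      ring
    rw [h3]
    exact J.mul_mem_left _ h1
  have hXD : X ^ N ∈ D := D.pow_mem (D.prod_mem hD) N
  -- `X ^ N` carries the saturation into `J`, so the inclusion for `y = X ^ N` collapses to `J`.
  obtain ⟨b, hb, c, hc, rfl⟩ := Submodule.mem_sup.1 (hXD (hK h hh))
  obtain ⟨c, hcN, rfl⟩ := Ideal.mem_span_singleton_mul.1 hc
  exact J.add_mem hb hcN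

/-- A criterion for an ideal to be saturated with respect to a product of elements. -/
theorem mem_of_prod_pow_mul_mem_of_insert [DecidableEq ι] (x : ι → A) (J : Ideal A) (R : Finset ι)
    (H : ∀ S ⊆ R, ∀ j ∈ R \ S, ∀ h,
      (∃ N : ℕ, (∏ i ∈ R \ S, x i) ^ N * h ∈ J ⊔ Ideal.span (x '' S)) →
      ∃ N : ℕ, (∏ i ∈ R \ insert j S, x i) ^ N * h ∈
        J ⊔ Ideal.span (x '' (insert j S : Finset ι)))
    {h : A} (hh : ∃ N : ℕ, (∏ i ∈ R, x i) ^ N * h ∈ J) : h ∈ J := by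
  -- The claim is made for all `J + (x i : i ∈ S)` at once, by induction on the number of
  -- coordinates not yet killed; for `S = R` the product is empty.
  suffices key : ∀ c, ∀ S ⊆ R, (R \ S).card = c → ∀ h,
      (∃ N : ℕ, (∏ i ∈ R \ S, x i) ^ N * h ∈ J ⊔ Ideal.span (x '' S)) →
        h ∈ J ⊔ Ideal.span (x '' S) by
    simpa using key _ ∅ (by simp) rfl h (by simpa using hh)
  intro c
  induction c with
  | zero =>
    rintro S - hc h ⟨N, hN⟩
    rw [Finset.card_eq_zero] at hc
    simpa [hc] using hN
  | succ c ih =>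
    intro S hS hc h hh
    refine mem_of_prod_pow_mul_mem x _ (R \ S) (fun j hj a ha => ?_) hh
    have hj' := Finset.mem_sdiff.1 hj
    have h1 := ih (insert j S) (Finset.insert_subset hj'.1 hS) ?_ a (H S hS j hj a ha)
    · rw [sup_assoc, ← Ideal.span_union, Set.union_singleton]
      simpa [Set.image_insert_eq] using h1
    · rw [Finset.sdiff_insert, Finset.card_erase_of_mem hj, hc, Nat.add_sub_cancel]

end Saturation

/-! ### Supports and initial forms -/

variable {k M : Type u} [Field k] [AddCommGroup M]

theorem mem_support_single_mul {v u : M} {a : AddMonoidAlgebra k M} :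
    v ∈ (AddMonoidAlgebra.single u 1 * a).coeff.support ↔ v - u ∈ a.coeff.support := by
  rw [AddMonoidAlgebra.support_coeff_single_mul _ _ (by simp)]
  simp only [Finset.mem_map, addLeftEmbedding_apply]
  constructor
  · rintro ⟨y, hy, rfl⟩; simpa using hy
  · intro h; exact ⟨_, h, by abel⟩

/-- If the terms of lowest weight in `p + q` are those of `p`, then `p` is the initial form. -/
theorem initialForm_add_of_lt {w : NReal M} {c : ℝ} {p q : AddMonoidAlgebra k M} (hp0 : p ≠ 0)
    (hp : ∀ v ∈ p.coeff.support, w v = c) (hq : ∀ v ∈ q.coeff.support, c < w v) :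
    initialForm w (p + q) = p := by
  classical
  have hdisj : ∀ v ∈ p.coeff.support, q.coeff v = 0 := fun v hv => by
    by_contra h
    exact (hq v (Finsupp.mem_support_iff.2 h)).ne' (hp v hv)
  have hsub : ∀ v ∈ p.coeff.support, v ∈ (p + q).coeff.support := fun v hv => by
    simpa [hdisj v hv] using hv
  have hle : ∀ v ∈ (p + q).coeff.support, c ≤ w v := fun v hv => by
    rcases Finset.mem_union.1 (Finsupp.support_add hv) with h | h
    exacts [(hp v h).ge, (hq v h).le]
  obtain ⟨v₀, hv₀⟩ : p.coeff.support.Nonempty := by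
    rw [Finsupp.support_nonempty_iff]; simpa using hp0
  apply AddMonoidAlgebra.coeff_injective
  ext v
  simp only [initialForm, Finsupp.filter_apply]
  split_ifs with h
  · by_cases hv : v ∈ q.coeff.support
    · have := h v₀ (hsub _ hv₀)
      have h2 := hq v hv
      rw [hp _ hv₀] at this
      linarith
    · simp [Finsupp.notMem_support_iff.1 hv]
  · by_contra hne
    have hv : v ∈ p.coeff.support := Finsupp.mem_support_iff.2 (Ne.symm hne)
    exact h fun v' hv' => (hp v hv).trans_le (hle v' hv')

theorem mem_support_initialForm {w : NReal M} {f : AddMonoidAlgebra k M} {v : M} :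
    v ∈ (initialForm w f).coeff.support ↔
      v ∈ f.coeff.support ∧ ∀ v' ∈ f.coeff.support, w v ≤ w v' := by
  classical
  simp only [initialForm, Finsupp.support_filter, Finset.mem_filter]

/-! ### Truncation to a set of exponents -/

section Truncate

/-- The sum of the terms of `a` with exponent in `P`. -/
def truncate {G : Type*} (P : Set G) : AddMonoidAlgebra k G →+ AddMonoidAlgebra k G :=
  open Classical in
  (AddMonoidAlgebra.coeffAddEquiv.symm.toAddMonoidHom.comp
    (Finsupp.filterAddHom (· ∈ P))).comp AddMonoidAlgebra.coeffAddEquiv.toAddMonoidHom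

theorem mem_support_truncate {G : Type*} {P : Set G} {a : AddMonoidAlgebra k G} {v : G} :
    v ∈ (truncate P a).coeff.support ↔ v ∈ a.coeff.support ∧ v ∈ P := by
  classical
  exact Finset.mem_filter

theorem truncate_single_of_mem {G : Type*} {P : Set G} {v : G} (hv : v ∈ P) (r : k) :
    truncate P (AddMonoidAlgebra.single v r) = AddMonoidAlgebra.single v r := by
  classical
  exact congrArg AddMonoidAlgebra.ofCoeff (Finsupp.filter_single_of_pos _ hv)

theorem truncate_single_of_notMem {G : Type*} {P : Set G} {v : G} (hv : v ∉ P) (r : k) :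
    truncate P (AddMonoidAlgebra.single v r) = 0 := by
  classical
  exact congrArg AddMonoidAlgebra.ofCoeff (Finsupp.filter_single_of_neg _ hv)

theorem truncate_eq_self {G : Type*} {P : Set G} {a : AddMonoidAlgebra k G}
    (h : ∀ v ∈ a.coeff.support, v ∈ P) : truncate P a = a := by
  classical
  refine congrArg AddMonoidAlgebra.ofCoeff ((Finsupp.filter_eq_self_iff _ _).2 fun v hv => ?_)
  exact h v (Finsupp.mem_support_iff.2 hv)

theorem mem_support_sub_truncate {G : Type*} {P : Set G} {a : AddMonoidAlgebra k G} {v : G}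
    (hv : v ∈ (a - truncate P a).coeff.support) : v ∈ a.coeff.support ∧ v ∉ P := by
  classical
  have h : (a - truncate P a).coeff = a.coeff - a.coeff.filter (· ∈ P) := rfl
  rw [h] at hv
  by_cases hP : v ∈ P <;> simp_all

/-- Multiplication by an element of `k[P]` preserves each coset of `P`, so projection to the trivial
coset is `k[P]`-linear. -/
theorem truncate_mul (P : AddSubgroup M) (a b : AddMonoidAlgebra k M)
    (hb : ∀ v ∈ b.coeff.support, v ∈ P) :
    truncate (P : Set M) (a * b) = truncate (P : Set M) a * b := by
  have hs : ∀ (v : M) (r : k), truncate (P : Set M) (AddMonoidAlgebra.single v r * b) =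
      truncate (P : Set M) (AddMonoidAlgebra.single v r) * b := by
    intro v r
    conv_lhs => rw [← b.sum_coeff_single]
    conv_rhs => rw [← b.sum_coeff_single]
    rw [Finsupp.sum, Finset.mul_sum, Finset.mul_sum, map_sum]
    refine Finset.sum_congr rfl fun y hy => ?_
    rw [AddMonoidAlgebra.single_mul_single]
    by_cases hv : v ∈ (P : Set M)
    · rw [truncate_single_of_mem hv, truncate_single_of_mem (P.add_mem hv (hb y hy)),
        AddMonoidAlgebra.single_mul_single]
    · rw [truncate_single_of_notMem hv, truncate_single_of_notMem, zero_mul]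
      exact fun h => hv ((P.add_mem_cancel_right (hb y hy)).1 h)
  induction a using AddMonoidAlgebra.induction_linear with
  | zero => simp
  | add f g hf hg => rw [add_mul, map_add, map_add, add_mul, hf, hg]
  | single v r => exact hs v r

end Truncate

/-! ### The coordinate ring inside `k[M]` -/

section Incl

variable {σ : PointedCone ℝ (NReal M)}

theorem incl_injective (σ : PointedCone ℝ (NReal M)) : Function.Injective (incl k σ) :=
  AddMonoidAlgebra.mapDomain_injective Subtype.val_injective

theorem incl_single (v : dualMonoid σ) (r : k) :
    incl k σ (AddMonoidAlgebra.single v r) = AddMonoidAlgebra.single (v : M) r :=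
  AddMonoidAlgebra.mapDomain_single

theorem coeff_incl (a : CoordRing k σ) (v : dualMonoid σ) :
    (incl k σ a).coeff (v : M) = a.coeff v :=
  Finsupp.mapDomain_apply Subtype.val_injective _ _

theorem mem_support_incl {a : CoordRing k σ} {v : M} (hv : v ∈ (incl k σ a).coeff.support) :
    ∃ h : v ∈ dualMonoid σ, ⟨v, h⟩ ∈ a.coeff.support := by
  classical
  obtain ⟨y, hy, rfl⟩ := Finset.mem_image.1 (Finsupp.mapDomain_support (f := Subtype.val) hv)
  exact ⟨y.2, hy⟩

theorem exists_incl_eq {p : AddMonoidAlgebra k M} (hp : ∀ v ∈ p.coeff.support, v ∈ dualMonoid σ) :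
    ∃ a, incl k σ a = p := by
  classical
  have hsum := p.sum_coeff_single
  rw [Finsupp.sum, ← Finset.sum_attach] at hsum
  refine ⟨∑ v ∈ p.coeff.support.attach,
    AddMonoidAlgebra.single ⟨v.1, hp _ v.2⟩ (p.coeff v.1), ?_⟩
  rw [map_sum]
  refine Eq.trans ?_ hsum
  exact Finset.sum_congr rfl fun v _ => incl_single _ _

/-- The ideal of the closure is the contraction of a radical ideal. -/
theorem closureIdeal_eq_comap {I : Ideal (AddMonoidAlgebra k M)} (hI : I.IsRadical) :
    closureIdeal σ I = I.comap (incl k σ).toRingHom := by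
  ext a
  rw [closureIdeal, PrimeSpectrum.vanishingIdeal_closure, PrimeSpectrum.mem_vanishingIdeal,
    Set.forall_mem_image, Ideal.mem_comap]
  conv_rhs => rw [← hI.radical, ← PrimeSpectrum.vanishingIdeal_zeroLocus_eq_radical,
    PrimeSpectrum.mem_vanishingIdeal]
  rfl

end Incl

/-! ### Coordinates on a unimodular chart -/

/-- Coordinates of a cone generated by part of a basis: the ray generators are the `e i` with
`i ∈ rays`, and `m` is the family dual to `e`. -/
structure ConeCoordinates (σ : PointedCone ℝ (NReal M)) (ι : Type*) [DecidableEq ι] where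
  /-- The functionals, elements of `N`. -/
  e : ι → (M →ₗ[ℤ] ℤ)
  /-- The family in `M` dual to the functionals. -/
  m : ι → M
  /-- The indices of the rays of the cone. -/
  rays : Finset ι
  e_m : ∀ i j, e i (m j) = if i = j then 1 else 0
  e_mem : ∀ i ∈ rays, latticeVector (e i) ∈ σ
  mem_dualMonoid : ∀ u, u ∈ dualMonoid σ ↔ ∀ i ∈ rays, 0 ≤ e i u

namespace ConeCoordinates

variable {σ : PointedCone ℝ (NReal M)} {ι : Type*} [DecidableEq ι] (C : ConeCoordinates σ ι)

theorem m_mem (i : ι) : C.m i ∈ dualMonoid σ := by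
  rw [C.mem_dualMonoid]
  intro j _
  rw [C.e_m]
  split_ifs <;> simp

variable (k) in
/-- The coordinate function `χ^{m i}` on `Y(σ)`. -/
def coord (i : ι) : CoordRing k σ := AddMonoidAlgebra.single ⟨C.m i, C.m_mem i⟩ 1

/-- The exponents on which the coordinates with index in `S` vanish. -/
def perp (S : Finset ι) : AddSubgroup M where
  carrier := {v | ∀ i ∈ S, C.e i v = 0}
  zero_mem' := by simp
  add_mem' ha hb i hi := by simp [ha i hi, hb i hi]
  neg_mem' ha i hi := by simp [ha i hi]

theorem mem_perp {S : Finset ι} {v : M} : v ∈ C.perp S ↔ ∀ i ∈ S, C.e i v = 0 := Iff.rfl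

/-- The ideal is monomial, and `χ^v` is divisible by the `i`-th coordinate exactly when `e i v > 0`:
subtracting `m i` lowers `e i` by one and leaves the other functionals unchanged. -/
theorem mem_span_coord {S : Finset ι} (hS : S ⊆ C.rays) {a : CoordRing k σ} :
    a ∈ Ideal.span (C.coord k '' S) ↔ ∀ v ∈ a.coeff.support, ∃ i ∈ S, 0 < C.e i v := by
  have h : C.coord k '' S = AddMonoidAlgebra.of' k (dualMonoid σ) ''
      ((fun i => (⟨C.m i, C.m_mem i⟩ : dualMonoid σ)) '' S) := by
    rw [Set.image_image]; rfl
  rw [h, AddMonoidAlgebra.mem_ideal_span_of'_image]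
  refine forall₂_congr fun v _ => ?_
  simp only [Set.exists_mem_image, Finset.mem_coe]
  refine exists_congr fun i => and_congr_right fun hi => ⟨?_, fun hpos => ?_⟩
  · rintro ⟨d, rfl⟩
    have h1 := (C.mem_dualMonoid d).1 d.2 i (hS hi)
    have h2 : C.e i (C.m i) = 1 := by simp [C.e_m]
    simp only [AddSubmonoid.coe_add, map_add, h2]
    omega
  · refine ⟨⟨v - C.m i, (C.mem_dualMonoid _).2 fun j hj => ?_⟩, by ext; simp⟩
    rw [map_sub, C.e_m]
    have h1 := (C.mem_dualMonoid v).1 v.2 j hj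
    split_ifs with hij
    · subst hij; omega
    · omega

theorem sub_truncate_mem_span {S : Finset ι} (hS : S ⊆ C.rays) (a : CoordRing k σ) :
    a - truncate (Subtype.val ⁻¹' (C.perp S : Set M)) a ∈ Ideal.span (C.coord k '' S) := by
  rw [C.mem_span_coord hS]
  intro v hv
  have h := (mem_support_sub_truncate hv).2
  simp only [Set.mem_preimage, SetLike.mem_coe, C.mem_perp, not_forall] at h
  obtain ⟨i, hi, hne⟩ := h
  exact ⟨i, hi, lt_of_le_of_ne ((C.mem_dualMonoid v).1 v.2 i (hS hi)) (Ne.symm hne)⟩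

theorem incl_prod_coord_pow (T : Finset ι) (N : ℕ) :
    incl k σ ((∏ i ∈ T, C.coord k i) ^ N) = AddMonoidAlgebra.single (N • ∑ i ∈ T, C.m i) 1 := by
  have h : incl k σ (∏ i ∈ T, C.coord k i) = AddMonoidAlgebra.single (∑ i ∈ T, C.m i) 1 := by
    rw [map_prod]
    induction T using Finset.induction_on with
    | empty => simp [AddMonoidAlgebra.one_def]
    | insert i T hi ih =>
      rw [Finset.prod_insert hi, Finset.sum_insert hi, ih, coord, incl_single,
        AddMonoidAlgebra.single_mul_single, mul_one]
  rw [map_pow, h, AddMonoidAlgebra.single_pow, one_pow]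

theorem e_nsmul_sum (T : Finset ι) (N : ℕ) (i : ι) :
    C.e i (N • ∑ j ∈ T, C.m j) = if i ∈ T then (N : ℤ) else 0 := by
  rw [map_nsmul, map_sum]
  simp [C.e_m]

/-- Multiplying by a power of the remaining coordinates moves an element with exponents in
`perp S` into the coordinate ring. -/
theorem exists_incl_eq_pow_mul {S : Finset ι} (p : AddMonoidAlgebra k M)
    (hp : ∀ v ∈ p.coeff.support, v ∈ C.perp S) :
    ∃ N₀ : ℕ, ∀ N ≥ N₀, ∃ a, incl k σ a =
      incl k σ ((∏ i ∈ C.rays \ S, C.coord k i) ^ N) * p := by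
  -- This bounds every pole order of `p`. Rays in `S` need no correction, as the exponents of `p`
  -- vanish there.
  refine ⟨p.coeff.support.sup fun v => C.rays.sup fun i => (C.e i v).natAbs, fun N hN =>
    exists_incl_eq fun v hv => (C.mem_dualMonoid v).2 fun i hi => ?_⟩
  rw [incl_prod_coord_pow, mem_support_single_mul] at hv
  set y := v - N • ∑ i ∈ C.rays \ S, C.m i with hy
  have hv' : v = N • ∑ i ∈ C.rays \ S, C.m i + y := by rw [hy]; abel
  rw [hv', map_add, e_nsmul_sum]
  split_ifs with h
  · have h1 : (C.e i y).natAbs ≤ N :=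
      (Finset.le_sup (f := fun i => (C.e i y).natAbs) hi).trans
        ((Finset.le_sup (f := fun v => C.rays.sup fun i => (C.e i v).natAbs) hv).trans hN)
    omega
  · have hiS : i ∈ S := by
      by_contra hn
      exact h (Finset.mem_sdiff.2 ⟨hi, hn⟩)
    rw [C.mem_perp.1 (hp y hv) i hiS]
    simp

/-! ### Weights in the cone and their initial forms -/

/-- The weight `∑_{i ∈ S} c eᵢ + eⱼ`. -/
def weight (S : Finset ι) (j : ι) (c : ℕ) : NReal M :=
  c • ∑ i ∈ S, latticeVector (C.e i) + latticeVector (C.e j)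

theorem weight_apply (S : Finset ι) (j : ι) (c : ℕ) (v : M) :
    C.weight S j c v = ((c * ∑ i ∈ S, C.e i v + C.e j v : ℤ) : ℝ) := by
  simp [weight, latticeVector, LinearMap.sum_apply]

theorem weight_mem {S : Finset ι} (hS : S ⊆ C.rays) {j : ι} (hj : j ∈ C.rays) (c : ℕ) :
    C.weight S j c ∈ σ :=
  add_mem (nsmul_mem (sum_mem fun i hi => C.e_mem i (hS hi)) c) (C.e_mem j hj)

/-- The factor `N + 1` makes a single positive value on `S` outweigh `N`, whatever the value of `e
j`. -/
theorem lt_weight {S : Finset ι} (hS : S ⊆ C.rays) {j : ι} (hj : j ∈ C.rays) {N : ℕ} {v : M}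
    (hv : v ∈ dualMonoid σ) (h : (∃ i ∈ S, 0 < C.e i v) ∨ (N : ℤ) < C.e j v) :
    (N : ℝ) < C.weight S j (N + 1) v := by
  rw [C.weight_apply]
  have h0 := (C.mem_dualMonoid v).1 hv
  have hsum : 0 ≤ ∑ i ∈ S, C.e i v := Finset.sum_nonneg fun i hi => h0 i (hS hi)
  have hj0 := h0 j hj
  have : (N : ℤ) < ((N + 1 : ℕ) : ℤ) * ∑ i ∈ S, C.e i v + C.e j v := by
    rcases h with ⟨i, hi, hpos⟩ | h
    · have h1 : 1 ≤ ∑ i ∈ S, C.e i v :=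
        le_trans hpos (Finset.single_le_sum (fun i hi => h0 i (hS hi)) hi)
      push_cast
      nlinarith
    · push_cast
      nlinarith
  exact_mod_cast this

theorem weight_eq {S : Finset ι} {j : ι} {N c : ℕ} {v : M}
    (hS : ∀ i ∈ S, C.e i v = 0) (hj : C.e j v = N) : C.weight S j c v = N := by
  rw [C.weight_apply, Finset.sum_eq_zero hS, hj]
  simp

theorem weight_pos {S : Finset ι} {j : ι} (hS : insert j S ⊆ C.rays) (N : ℕ)
    {v : M} (hv : v ∈ dualMonoid σ) (h : ∃ i ∈ insert j S, 0 < C.e i v) :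
    0 < C.weight S j (N + 1) v := by
  rw [C.weight_apply]
  have h0 := (C.mem_dualMonoid v).1 hv
  have hS0 : ∀ i ∈ S, 0 ≤ C.e i v := fun i hi => h0 i (hS (Finset.mem_insert_of_mem hi))
  have hsum : 0 ≤ ∑ i ∈ S, C.e i v := Finset.sum_nonneg hS0
  have hj0 := h0 j (hS (Finset.mem_insert_self j S))
  have : 0 < ((N + 1 : ℕ) : ℤ) * ∑ i ∈ S, C.e i v + C.e j v := by
    obtain ⟨i, hi, hpos⟩ := h
    rcases Finset.mem_insert.1 hi with rfl | hi
    · positivity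
    · have h1 : 0 < ∑ i ∈ S, C.e i v := hpos.trans_le (Finset.single_le_sum hS0 hi)
      positivity
  exact_mod_cast this

variable {S : Finset ι} {j : ι}

/-- For `a` in the coordinate ring with nonzero constant term, the initial form of a translate of
`a` is the translate of the truncation of `a`. -/
theorem initialForm_weight_single_mul (hS : insert j S ⊆ C.rays) (N : ℕ) (u : M)
    {a : CoordRing k σ} (ha : 0 ∈ a.coeff.support) :
    initialForm (C.weight S j (N + 1)) (AddMonoidAlgebra.single u 1 * incl k σ a) =
      AddMonoidAlgebra.single u 1 *
        incl k σ (truncate (Subtype.val ⁻¹' (C.perp (insert j S) : Set M)) a) := by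
  set a₀ := truncate (Subtype.val ⁻¹' (C.perp (insert j S) : Set M)) a with ha₀
  have hsplit : AddMonoidAlgebra.single u 1 * incl k σ a =
      AddMonoidAlgebra.single u 1 * incl k σ a₀ +
        AddMonoidAlgebra.single u 1 * incl k σ (a - a₀) := by
    rw [map_sub]; ring
  have h0 : (0 : dualMonoid σ) ∈ a₀.coeff.support :=
    mem_support_truncate.2 ⟨ha, (C.perp _).zero_mem⟩
  rw [hsplit]
  refine initialForm_add_of_lt (c := C.weight S j (N + 1) u) ?_ ?_ ?_
  · intro hz
    have h1 : u ∈ (AddMonoidAlgebra.single u 1 * incl k σ a₀).coeff.support := by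
      rw [mem_support_single_mul, sub_self, Finsupp.mem_support_iff]
      exact (coeff_incl a₀ 0).trans_ne (Finsupp.mem_support_iff.1 h0)
    simp [hz] at h1
  · intro v hv
    rw [mem_support_single_mul] at hv
    obtain ⟨hd, hv⟩ := mem_support_incl hv
    have hP : v - u ∈ C.perp (insert j S) := (mem_support_truncate.1 hv).2
    have h1 : C.weight S j (N + 1) (v - u) = 0 := by
      have := C.weight_eq (N := 0) (c := N + 1) (fun i hi => hP i (Finset.mem_insert_of_mem hi))
        (by simpa using hP j (Finset.mem_insert_self j S))
      simpa using this
    rw [map_sub] at h1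
    linarith
  · intro v hv
    rw [mem_support_single_mul] at hv
    obtain ⟨hd, hv⟩ := mem_support_incl hv
    have h1 := C.weight_pos hS N hd
      ((C.mem_span_coord hS).1 (C.sub_truncate_mem_span hS a) _ hv)
    rw [map_sub] at h1
    linarith

/-- If `X ^ N * h ≡ q` modulo the coordinates in `S`, then the initial form of `q` is the truncation
of `h` multiplied by `X ^ N`. -/
theorem initialForm_weight_of_add_eq (hS : S ⊆ C.rays) (hj : j ∈ C.rays \ S) (N : ℕ)
    {h q p : CoordRing k σ} (hp : p ∈ Ideal.span (C.coord k '' S))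
    (hqp : q + p = (∏ i ∈ C.rays \ S, C.coord k i) ^ N * h)
    (h0 : truncate (Subtype.val ⁻¹' (C.perp (insert j S) : Set M)) h ≠ 0) :
    initialForm (C.weight S j (N + 1)) (incl k σ q) =
      incl k σ ((∏ i ∈ C.rays \ S, C.coord k i) ^ N *
        truncate (Subtype.val ⁻¹' (C.perp (insert j S) : Set M)) h) := by
  have hj' := Finset.mem_sdiff.1 hj
  have hS' : insert j S ⊆ C.rays := Finset.insert_subset hj'.1 hS
  set h₀ := truncate (Subtype.val ⁻¹' (C.perp (insert j S) : Set M)) h with hh₀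
  set X := (∏ i ∈ C.rays \ S, C.coord k i) ^ N with hX
  -- The first summand has weight exactly `N`, contributed by the `j`-th coordinate in `X`. A term
  -- of the others either is positive on some `i ∈ S` or has `e j > N`, hence is heavier.
  have hsplit : incl k σ q = incl k σ (X * h₀) + (incl k σ (X * (h - h₀)) - incl k σ p) := by
    rw [← map_sub, ← map_add]
    congr 1
    linear_combination hqp
  have hXs : ∀ a : CoordRing k σ, incl k σ (X * a) =
      AddMonoidAlgebra.single (N • ∑ i ∈ C.rays \ S, C.m i) 1 * incl k σ a := fun a => by
    rw [map_mul, hX, C.incl_prod_coord_pow]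
  have heS : ∀ i ∈ S, C.e i (N • ∑ i ∈ C.rays \ S, C.m i) = 0 := fun i hi => by
    rw [C.e_nsmul_sum, if_neg (by simp [hi])]
  have hej : C.e j (N • ∑ i ∈ C.rays \ S, C.m i) = N := by
    rw [C.e_nsmul_sum, if_pos hj]
  rw [hsplit]
  refine initialForm_add_of_lt (c := N) ?_ ?_ ?_
  · rw [hXs]
    intro hz
    apply h0
    apply incl_injective σ
    rw [map_zero]
    have := congrArg (AddMonoidAlgebra.single (-(N • ∑ i ∈ C.rays \ S, C.m i)) (1 : k) * ·) hz
    simpa [← mul_assoc, AddMonoidAlgebra.single_mul_single, ← AddMonoidAlgebra.one_def] using this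
  · intro v hv
    rw [hXs, mem_support_single_mul] at hv
    obtain ⟨hd, hv⟩ := mem_support_incl hv
    have hP : _ ∈ C.perp (insert j S) := (mem_support_truncate.1 hv).2
    refine C.weight_eq (fun i hi => ?_) ?_
    · have := hP i (Finset.mem_insert_of_mem hi)
      rw [map_sub, heS i hi] at this
      omega
    · have := hP j (Finset.mem_insert_self j S)
      rw [map_sub, hej] at this
      omega
  · intro v hv
    classical
    rcases Finset.mem_union.1 (Finsupp.support_sub hv) with hv | hv
    · change v ∈ (incl k σ (X * (h - h₀))).coeff.support at hv
      obtain ⟨hd', -⟩ := mem_support_incl hv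
      rw [hXs, mem_support_single_mul] at hv
      obtain ⟨hd, hv⟩ := mem_support_incl hv
      obtain ⟨i, hi, hpos⟩ := (C.mem_span_coord hS').1 (C.sub_truncate_mem_span hS' h) _ hv
      refine C.lt_weight hS hj'.1 hd' ?_
      rcases Finset.mem_insert.1 hi with rfl | hi
      · right
        rw [map_sub, hej] at hpos
        omega
      · left
        rw [map_sub, heS i hi] at hpos
        exact ⟨i, hi, by omega⟩
    · obtain ⟨hd, hv⟩ := mem_support_incl hv
      exact C.lt_weight hS hj'.1 hd (Or.inl ((C.mem_span_coord hS).1 hp _ hv))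

/-! ### Descent to the coordinate ring and the inductive step -/

/-- Descending a relation among elements with exponents in `perp S` from `k[M]` to the coordinate
ring. -/
theorem exists_pow_mul_mem_span {κ : Type*} [Finite κ] (a : κ → CoordRing k σ) (b : CoordRing k σ)
    (ha : ∀ l, ∀ v ∈ (a l).coeff.support, (v : M) ∈ C.perp S)
    (hb : ∀ v ∈ b.coeff.support, (v : M) ∈ C.perp S)
    (h : incl k σ b ∈ Ideal.span (Set.range fun l => incl k σ (a l))) :
    ∃ N : ℕ, (∏ i ∈ C.rays \ S, C.coord k i) ^ N * b ∈ Ideal.span (Set.range a) := by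
  cases nonempty_fintype κ
  obtain ⟨c, hc⟩ := Ideal.mem_span_range_iff_exists_fun.1 h
  have hperp : ∀ {x : CoordRing k σ}, (∀ v ∈ x.coeff.support, (v : M) ∈ C.perp S) →
      ∀ v ∈ (incl k σ x).coeff.support, v ∈ C.perp S := fun hx v hv => by
    obtain ⟨hd, hv⟩ := mem_support_incl hv
    exact hx _ hv
  -- Truncation is linear over `k[perp S]`, so the coefficients may be taken with exponents in `perp
  -- S`; only coordinates outside `S` can then have poles to clear.
  have hc' := congrArg (truncate (C.perp S : Set M)) hc
  rw [truncate_eq_self (hperp hb), map_sum] at hc'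
  simp_rw [fun l => truncate_mul (C.perp S) (c l) _ (hperp (ha l))] at hc'
  choose N₀ hN₀ using fun l => C.exists_incl_eq_pow_mul (S := S) (truncate (C.perp S : Set M) (c l))
    (fun v hv => (mem_support_truncate.1 hv).2)
  refine ⟨Finset.univ.sup N₀, ?_⟩
  choose c' hc'' using fun l => hN₀ l (Finset.univ.sup N₀) (Finset.le_sup (Finset.mem_univ l))
  refine Ideal.mem_span_range_iff_exists_fun.2 ⟨c', incl_injective σ ?_⟩
  rw [map_mul, ← hc', Finset.mul_sum, map_sum]
  exact Finset.sum_congr rfl fun l _ => by rw [map_mul, hc'', mul_assoc]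

/-- The step of the saturation criterion, and the only place where generation of initial ideals is
used: a suitable weight extracts from `q ∈ J` a relation for the part of `h` free of the coordinates
in `insert j S`. -/
theorem exists_pow_mul_mem_insert {κ : Type*} [Finite κ] {f : κ → AddMonoidAlgebra k M} {u : κ → M}
    {g : κ → CoordRing k σ} {I : Ideal (AddMonoidAlgebra k M)} (hf : ∀ l, f l ∈ I)
    (hg : ∀ l, incl k σ (g l) = AddMonoidAlgebra.single (u l) 1 * f l)
    (hg0 : ∀ l, 0 ∈ (g l).coeff.support)
    (hgen : ∀ w ∈ σ, Ideal.span (Set.range fun l => initialForm w (f l)) = initialIdeal w I)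
    (hS : S ⊆ C.rays) (hj : j ∈ C.rays \ S) (h : CoordRing k σ)
    (hh : ∃ N : ℕ, (∏ i ∈ C.rays \ S, C.coord k i) ^ N * h ∈
      Ideal.span (Set.range g) ⊔ Ideal.span (C.coord k '' S)) :
    ∃ N : ℕ, (∏ i ∈ C.rays \ insert j S, C.coord k i) ^ N * h ∈
      Ideal.span (Set.range g) ⊔ Ideal.span (C.coord k '' (insert j S : Finset ι)) := by
  obtain ⟨N, hN⟩ := hh
  obtain ⟨q, hq, p, hp, hqp⟩ := Submodule.mem_sup.1 hN
  have hj' := Finset.mem_sdiff.1 hj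
  have hS' : insert j S ⊆ C.rays := Finset.insert_subset hj'.1 hS
  set P : Set (dualMonoid σ) := Subtype.val ⁻¹' (C.perp (insert j S) : Set M) with hP
  set X' := ∏ i ∈ C.rays \ insert j S, C.coord k i with hX'
  have hrest := C.sub_truncate_mem_span hS' h
  -- In this degenerate case `h` already lies in the ideal of the coordinates, and the zeroth power
  -- suffices.
  by_cases h0 : truncate P h = 0
  · rw [← hP, h0, sub_zero] at hrest
    exact ⟨0, by simpa using Ideal.mem_sup_right hrest⟩
  have hqI : incl k σ q ∈ I := by
    have : Ideal.span (Set.range g) ≤ I.comap (incl k σ).toRingHom := by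
      rw [Ideal.span_le]
      rintro _ ⟨l, rfl⟩
      change incl k σ (g l) ∈ I
      rw [hg]
      exact I.mul_mem_left _ (hf l)
    exact this hq
  have hin := C.initialForm_weight_of_add_eq hS hj N hp hqp h0
  have hmem : initialForm (C.weight S j (N + 1)) (incl k σ q) ∈
      Ideal.span (Set.range fun l => incl k σ (truncate P (g l))) := by
    have h1 : initialForm (C.weight S j (N + 1)) (incl k σ q) ∈
        initialIdeal (C.weight S j (N + 1)) I := Ideal.subset_span ⟨_, hqI, rfl⟩
    rw [← hgen _ (C.weight_mem hS hj'.1 _)] at h1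
    refine (Ideal.span_le.2 ?_) h1
    rintro _ ⟨l, rfl⟩
    have hfl : f l = AddMonoidAlgebra.single (-u l) 1 * incl k σ (g l) := by
      rw [hg, ← mul_assoc, AddMonoidAlgebra.single_mul_single, neg_add_cancel, one_mul,
        ← AddMonoidAlgebra.one_def, one_mul]
    change initialForm (C.weight S j (N + 1)) (f l) ∈ Ideal.span _
    rw [hfl, C.initialForm_weight_single_mul hS' N _ (hg0 l)]
    exact Ideal.mul_mem_left _ _ (Ideal.subset_span ⟨l, rfl⟩)
  rw [hin] at hmem
  have hmem' : incl k σ (X' ^ N * truncate P h) ∈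
      Ideal.span (Set.range fun l => incl k σ (truncate P (g l))) := by
    -- The `j`-th coordinate is a unit in `k[M]`; removing its `N`-th power leaves only exponents in
    -- `perp (insert j S)`, as descent requires.
    have h1 := Ideal.mul_mem_left _ (AddMonoidAlgebra.single (-(N • C.m j)) 1) hmem
    convert h1 using 1
    rw [map_mul, map_mul, ← mul_assoc, hX', C.incl_prod_coord_pow, C.incl_prod_coord_pow,
      AddMonoidAlgebra.single_mul_single, one_mul]
    congr 2
    rw [Finset.sdiff_insert, ← Finset.add_sum_erase _ _ hj, smul_add]
    abel
  have hXP : ∀ v ∈ (X' ^ N * truncate P h).coeff.support, (v : M) ∈ C.perp (insert j S) := by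
    intro v hv
    have hv' : (v : M) ∈ (incl k σ (X' ^ N * truncate P h)).coeff.support := by
      rw [Finsupp.mem_support_iff, coeff_incl]
      exact Finsupp.mem_support_iff.1 hv
    rw [map_mul, hX', C.incl_prod_coord_pow, mem_support_single_mul] at hv'
    obtain ⟨hd, hv'⟩ := mem_support_incl hv'
    have h1 : _ ∈ C.perp (insert j S) := (mem_support_truncate.1 hv').2
    intro i hi
    have h2 := h1 i hi
    rwa [map_sub, C.e_nsmul_sum, if_neg fun hn => (Finset.mem_sdiff.1 hn).2 hi, sub_zero] at h2
  obtain ⟨N', hN'⟩ := C.exists_pow_mul_mem_span (S := insert j S) (fun l => truncate P (g l)) _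
    (fun l v hv => (mem_support_truncate.1 hv).2) hXP hmem'
  have hle : Ideal.span (Set.range fun l => truncate P (g l)) ≤
      Ideal.span (Set.range g) ⊔ Ideal.span (C.coord k '' (insert j S : Finset ι)) := by
    rw [Ideal.span_le]
    rintro _ ⟨l, rfl⟩
    have h1 := Ideal.sub_mem _
      (Ideal.mem_sup_left (T := Ideal.span (C.coord k '' (insert j S : Finset ι)))
        (Ideal.subset_span (Set.mem_range_self (f := g) l)))
      (Ideal.mem_sup_right (S := Ideal.span (Set.range g)) (C.sub_truncate_mem_span hS' (g l)))
    simpa using h1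
  refine ⟨N' + N, ?_⟩
  have hfin : X' ^ (N' + N) * h = X' ^ N' * (X' ^ N * truncate P h) +
      X' ^ (N' + N) * (h - truncate P h) := by ring
  rw [hfin]
  exact Ideal.add_mem _ (hle hN') (Ideal.mul_mem_left _ _ (Ideal.mem_sup_right hrest))

/-- If the initial forms of the `f l` generate all initial ideals along `σ`, then their normalized
translates generate the contraction of the ideal of the `f l`. -/
theorem mem_span_range_of_incl_mem (C : ConeCoordinates σ ι) [IsNoetherianRing (CoordRing k σ)] {κ : Type*} [Finite κ]
    {f : κ → AddMonoidAlgebra k M} {u : κ → M} {g : κ → CoordRing k σ}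
    (hg : ∀ l, incl k σ (g l) = AddMonoidAlgebra.single (u l) 1 * f l)
    (hg0 : ∀ l, 0 ∈ (g l).coeff.support)
    (hgen : ∀ w ∈ σ, Ideal.span (Set.range fun l => initialForm w (f l)) =
      initialIdeal w (Ideal.span (Set.range f)))
    {h : CoordRing k σ} (hh : incl k σ h ∈ Ideal.span (Set.range f)) :
    h ∈ Ideal.span (Set.range g) := by
  refine mem_of_prod_pow_mul_mem_of_insert (C.coord k) _ C.rays
    (fun S hS j hj a ha => C.exists_pow_mul_mem_insert
      (fun l => Ideal.subset_span (Set.mem_range_self l)) hg hg0 hgen hS hj a ha) ?_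
  -- For `S = ∅` the subgroup `perp S` is all of `M`, so descent says that the contraction lies in
  -- the saturation of the span of `g`.
  have h1 := C.exists_pow_mul_mem_span (S := ∅) g h (by simp [C.mem_perp]) (by simp [C.mem_perp]) ?_
  · simpa using h1
  · refine (Ideal.span_le.2 ?_) hh
    rintro _ ⟨l, rfl⟩
    have hfl : f l = AddMonoidAlgebra.single (-u l) 1 * incl k σ (g l) := by
      rw [hg, ← mul_assoc, AddMonoidAlgebra.single_mul_single, neg_add_cancel, one_mul,
        ← AddMonoidAlgebra.one_def, one_mul]
    rw [hfl]
    exact Ideal.mul_mem_left _ _ (Ideal.subset_span ⟨l, rfl⟩)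

end ConeCoordinates

/-! ### Unimodular cones: dual bases, finite generation, relative interior -/

theorem continuous_eval (u : M) : Continuous fun w : NReal M => w u :=
  (continuous_apply u).comp continuous_induced_dom

theorem latticeVector_apply (v : M →ₗ[ℤ] ℤ) (u : M) : latticeVector v u = (v u : ℝ) := rfl

theorem mem_dualMonoid_hull {ι : Type*} (b : Module.Basis ι ℤ (M →ₗ[ℤ] ℤ))
    {s : Finset ι} {u : M} :
    u ∈ dualMonoid (PointedCone.hull ℝ ((fun i => latticeVector (b i)) '' (s : Set ι))) ↔
      ∀ i ∈ s, 0 ≤ b i u := by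
  constructor
  · intro h i hi
    have : (0 : ℝ) ≤ (b i u : ℝ) := h _ (Submodule.subset_span ⟨i, hi, rfl⟩)
    exact_mod_cast this
  · intro h w hw
    induction hw using Submodule.span_induction with
    | mem x hx =>
      obtain ⟨i, hi, rfl⟩ := hx
      exact Int.cast_nonneg (h i hi)
    | zero => simp
    | add x y _ _ hx hy => simpa using add_nonneg hx hy
    | smul a x _ hx => exact mul_nonneg a.2 hx

section Basis

variable [Module.Free ℤ M] [Module.Finite ℤ M] {ι : Type*} [DecidableEq ι]
  (b : Module.Basis ι ℤ (M →ₗ[ℤ] ℤ))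

/-- The basis of `M` dual to a basis of `N`. -/
def dualVector (i : ι) : M := (Module.evalEquiv ℤ M).symm (b.coord i)

theorem basis_dualVector (i j : ι) : b i (dualVector b j) = if i = j then 1 else 0 := by
  have := Module.apply_evalEquiv_symm_apply (R := ℤ) (M := M) (b i) (b.coord j)
  rw [dualVector, this, Module.Basis.coord_apply, Module.Basis.repr_self, Finsupp.single_apply]

variable [Fintype ι]

theorem sum_smul_dualVector (u : M) : ∑ i, b i u • dualVector b i = u := by
  apply (Module.evalEquiv ℤ M).injective
  refine b.ext fun j => ?_
  simp [basis_dualVector]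

theorem sum_apply_dualVector_smul (w : NReal M) :
    ∑ i, w (dualVector b i) • latticeVector (b i) = w := by
  ext u
  conv_rhs => rw [← sum_smul_dualVector b u]
  simp [LinearMap.sum_apply, latticeVector_apply, mul_comm]

/-- The coordinates of a unimodular cone. -/
def coneCoordinates (s : Finset ι) :
    ConeCoordinates (PointedCone.hull ℝ ((fun i => latticeVector (b i)) '' (s : Set ι))) ι where
  e := b
  m := dualVector b
  rays := s
  e_m := basis_dualVector b
  e_mem i hi := Submodule.subset_span ⟨i, hi, rfl⟩
  mem_dualMonoid _ := mem_dualMonoid_hull b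

/-- In the dual basis this monoid is a product of copies of `ℕ` (indices in `s`) and `ℤ` (the
others), so negatives are needed only off `s`. -/
theorem fg_dualMonoid_hull (s : Finset ι) : AddMonoid.FG
    (dualMonoid (PointedCone.hull ℝ ((fun i => latticeVector (b i)) '' (s : Set ι)))) := by
  rw [AddMonoid.fg_iff_addSubmonoid_fg, AddSubmonoid.fg_iff]
  refine ⟨Set.range (dualVector b) ∪ (fun i => -dualVector b i) '' {i | i ∉ s}, ?_,
    (Set.finite_range _).union ((Set.toFinite _).image _)⟩
  apply le_antisymm
  · rw [AddSubmonoid.closure_le]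
    rintro _ (⟨i, rfl⟩ | ⟨i, hi, rfl⟩)
    · exact (coneCoordinates b s).m_mem i
    · rw [SetLike.mem_coe, mem_dualMonoid_hull]
      intro j hj
      have : j ≠ i := fun h => hi (h ▸ hj)
      simp [basis_dualVector, this]
  · intro u hu
    rw [mem_dualMonoid_hull] at hu
    rw [← sum_smul_dualVector b u]
    refine sum_mem fun i _ => ?_
    rcases le_total 0 (b i u) with h | h
    · lift b i u to ℕ using h with c
      rw [natCast_zsmul]
      refine AddSubmonoid.nsmul_mem _ ?_ c
      exact AddSubmonoid.subset_closure (Or.inl ⟨i, rfl⟩)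
    · by_cases hi : i ∈ s
      · rw [le_antisymm h (hu i hi), zero_smul]
        exact zero_mem _
      · obtain ⟨c, hc⟩ := Int.eq_ofNat_of_zero_le (neg_nonneg.2 h)
        have : b i u • dualVector b i = c • (-dualVector b i) := by
          rw [← natCast_zsmul, smul_neg, ← hc, neg_smul, neg_neg]
        rw [this]
        refine AddSubmonoid.nsmul_mem _ ?_ c
        exact AddSubmonoid.subset_closure (Or.inr ⟨i, hi, rfl⟩)

theorem isNoetherianRing_coordRing_hull (s : Finset ι) : IsNoetherianRing
    (CoordRing k (PointedCone.hull ℝ ((fun i => latticeVector (b i)) '' (s : Set ι)))) :=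
  have := fg_dualMonoid_hull b s
  Algebra.FiniteType.isNoetherianRing k _

/-- Positive combinations of the ray generators of a unimodular cone are relatively interior. -/
theorem sum_smul_mem_relint_hull (s : Finset ι) {c : ι → ℝ} (hc : ∀ i ∈ s, 0 < c i) :
    ∑ i ∈ s, c i • latticeVector (b i) ∈
      relint (PointedCone.hull ℝ ((fun i => latticeVector (b i)) '' (s : Set ι))) := by
  set σ := PointedCone.hull ℝ ((fun i => latticeVector (b i)) '' (s : Set ι)) with hσ
  have hmem : ∀ c : ι → ℝ, (∀ i ∈ s, 0 ≤ c i) → ∑ i ∈ s, c i • latticeVector (b i) ∈ σ := by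
    intro c hc
    refine sum_mem fun i hi => ?_
    exact Submodule.smul_mem _ (⟨c i, hc i hi⟩ : {r : ℝ // 0 ≤ r})
      (Submodule.subset_span ⟨i, hi, rfl⟩)
  -- `L` contains the affine span of `σ`. Within `L` only the coordinates in `s` survive, so their
  -- positivity is an open condition that forces membership in `σ`.
  let L : Submodule ℝ (NReal M) :=
    { carrier := {w | ∀ i ∉ s, w (dualVector b i) = 0}
      zero_mem' := by simp
      add_mem' := fun hx hy i hi => by simp [hx i hi, hy i hi]
      smul_mem' := fun r x hx i hi => by simp [hx i hi] }
  have hσL : ∀ w ∈ σ, w ∈ L := by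
    intro w hw
    induction hw using Submodule.span_induction with
    | mem x hx =>
      obtain ⟨i, hi, rfl⟩ := hx
      intro j hj
      have : i ≠ j := fun h => hj (h ▸ hi)
      simp [latticeVector_apply, basis_dualVector, this]
    | zero => exact L.zero_mem
    | add x y _ _ hx hy => exact L.add_mem hx hy
    | smul a x _ hx => exact L.smul_mem (a : ℝ) hx
  have hspan : affineSpan ℝ (σ : Set (NReal M)) ≤ L.toAffineSubspace :=
    affineSpan_le.2 hσL
  have hp := hmem c fun i hi => (hc i hi).le
  refine mem_intrinsicInterior.2 ⟨⟨_, subset_affineSpan ℝ _ hp⟩, ?_, rfl⟩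
  rw [mem_interior]
  refine ⟨{w | ∀ i ∈ s, 0 < w.1 (dualVector b i)}, ?_, ?_, ?_⟩
  · intro w hw
    have hwL : w.1 ∈ L := hspan w.2
    have h1 := sum_apply_dualVector_smul b w.1
    rw [← Finset.sum_subset (Finset.subset_univ s)
      (fun i _ hi => by rw [hwL i hi, zero_smul])] at h1
    change w.1 ∈ σ
    rw [← h1]
    exact hmem _ fun i hi => (hw i hi).le
  · simp only [Set.ofPred_forall]
    exact isOpen_biInter_finset fun i _ =>
      isOpen_lt continuous_const ((continuous_eval _).comp continuous_subtype_val)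
  · intro i hi
    have : (∑ j ∈ s, c j • latticeVector (b j) : NReal M) (dualVector b i) = c i := by
      simp [LinearMap.sum_apply, latticeVector_apply, basis_dualVector, hi]
    change 0 < (∑ j ∈ s, c j • latticeVector (b j) : NReal M) (dualVector b i)
    rw [this]
    exact hc i hi

/-- An exponent whose weight is minimal on the relative interior has minimal weight on each ray. -/
theorem apply_le_of_forall_relint {s : Finset ι} {v v' : M}
    (h : ∀ w ∈ relint (PointedCone.hull ℝ ((fun i => latticeVector (b i)) '' (s : Set ι))),
      w v ≤ w v') {i : ι} (hi : i ∈ s) : b i v ≤ b i v' := by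
  by_contra! hlt
  have hlt' : (1 : ℝ) ≤ b i v - b i v' := by
    have : 1 ≤ b i v - b i v' := by omega
    exact_mod_cast this
  -- Test on `w = ∑ b j + t • b i`: the weight of `v'` minus that of `v` is `D + t (b i v' - b i v)
  -- ≤ D - t`, negative once `t > D`.
  set D : ℝ := ∑ j ∈ s, ((b j v' : ℝ) - b j v) with hD
  obtain ⟨t, ht⟩ := exists_nat_gt D
  have h1 := h _ (sum_smul_mem_relint_hull b s (c := fun j => if j = i then 1 + t else 1)
    (fun j _ => by split_ifs <;> positivity))
  have h2 : ∀ y : M, (∑ j ∈ s, (if j = i then 1 + (t : ℝ) else 1) • latticeVector (b j) : NReal M) y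
      = ∑ j ∈ s, (b j y : ℝ) + t * b i y := by
    intro y
    have : ∀ j ∈ s, (if j = i then 1 + (t : ℝ) else 1) * (b j y : ℝ) =
        b j y + if j = i then t * (b j y : ℝ) else 0 := by
      intro j _
      split_ifs <;> ring
    simp only [LinearMap.sum_apply, LinearMap.smul_apply, latticeVector_apply, smul_eq_mul]
    rw [Finset.sum_congr rfl this, Finset.sum_add_distrib, Finset.sum_ite_eq' s i, if_pos hi]
  rw [h2, h2] at h1
  rw [Finset.sum_sub_distrib] at hD
  have ht0 : (0 : ℝ) ≤ t := Nat.cast_nonneg t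
  nlinarith

end Basis

end Toric

end

/-! ### The main theorem -/

theorem mainTheorem10 {k : Type u} [Field k] [IsAlgClosed k]
    {M : Type u} [AddCommGroup M] [Module.Free ℤ M] [Module.Finite ℤ M]
    (n d : ℕ) (hn : 0 < n) (hM : Module.finrank ℤ M = n) (hd : 0 < d) (hdn : d ≤ n)
    (f : Fin (n - d) → AddMonoidAlgebra k M) (I : Ideal (AddMonoidAlgebra k M))
    (hI : I = Ideal.span (Set.range f))
    (Δ Δbar : Toric.Fan M) (σ : PointedCone ℝ (Toric.NReal M)) (hσ : σ ∈ Δbar.cones)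
    (hpure : Toric.IsPureOfDim (Toric.subscheme I) d)
    (hred : AlgebraicGeometry.IsReduced (Toric.subscheme I))
    (hsub : Δ.cones ⊆ Δbar.cones)
    (hunim : ∀ τ ∈ Δbar.cones, Toric.IsUnimodular τ)
    (htrop : Δ.IsTropical I)
    (hconst : ∀ τ, Toric.IsFace τ σ → ∀ w₁ ∈ Toric.relint τ, ∀ w₂ ∈ Toric.relint τ,
      ∀ i, Toric.initialForm w₁ (f i) = Toric.initialForm w₂ (f i))
    (hgen : ∀ w ∈ σ, Ideal.span (Set.range fun i => Toric.initialForm w (f i)) =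
      Toric.initialIdeal w I) :
    (∀ i, ∀ v : M,
      (∀ w ∈ Toric.relint σ, v ∈ (Toric.initialForm w (f i)).coeff.support) ↔
        ∃ w ∈ Toric.relint σ, v ∈ (Toric.initialForm w (f i)).coeff.support) ∧
    ∀ u : Fin (n - d) → M,
      (∀ i, ∃ w ∈ Toric.relint σ, -u i ∈ (Toric.initialForm w (f i)).coeff.support) →
      ∃ g : Fin (n - d) → Toric.CoordRing k σ,
        (∀ i, Toric.incl k σ (g i) = AddMonoidAlgebra.single (u i) 1 * f i) ∧
        Ideal.span (Set.range g) = Toric.closureIdeal σ I := by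
  classical
  obtain ⟨b, s, hbs⟩ := hunim σ hσ
  obtain ⟨s, rfl⟩ := s.toFinite.exists_finset_coe
  have hface : Toric.IsFace σ σ := ⟨0, zero_mem _, by simp⟩
  subst hbs
  set σ := PointedCone.hull ℝ ((fun i => Toric.latticeVector (b i)) '' (s : Set _)) with hσdef
  -- The sum of the ray generators witnesses that the relative interior is nonempty, as "for all
  -- implies for some" requires.
  have hne := Toric.sum_smul_mem_relint_hull b s (c := fun _ => 1) (fun _ _ => one_pos)
  have hiff : ∀ i, ∀ v : M,
      (∀ w ∈ Toric.relint σ, v ∈ (Toric.initialForm w (f i)).coeff.support) ↔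
        ∃ w ∈ Toric.relint σ, v ∈ (Toric.initialForm w (f i)).coeff.support := by
    refine fun i v => ⟨fun h => ⟨_, hne, h _ hne⟩, ?_⟩
    rintro ⟨w, hw, hv⟩ w' hw'
    rwa [hconst σ hface w' hw' w hw i]
  refine ⟨hiff, fun u hu => ?_⟩
  have hu' := fun i => (hiff i _).2 (hu i)
  have hle : ∀ i, ∀ v ∈ (f i).coeff.support, ∀ l ∈ s, b l (-u i) ≤ b l v :=
    fun i v hv l hl => Toric.apply_le_of_forall_relint b
      (fun w hw => (Toric.mem_support_initialForm.1 (hu' i w hw)).2 v hv) hl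
  have hex : ∀ i, ∃ a, Toric.incl k σ a = AddMonoidAlgebra.single (u i) 1 * f i := by
    refine fun i => Toric.exists_incl_eq fun v hv => (Toric.mem_dualMonoid_hull b).2 fun l hl => ?_
    rw [Toric.mem_support_single_mul] at hv
    have := hle i _ hv l hl
    rw [map_neg, map_sub] at this
    omega
  choose g hg using hex
  refine ⟨g, hg, ?_⟩
  -- The term of `f i` at `-u i` becomes the constant term, which has least weight on all of `σ`;
  -- this controls the initial forms of `f i` along every face.
  have hg0 : ∀ i, 0 ∈ (g i).coeff.support := by
    intro i
    have h1 : (0 : M) ∈ (Toric.incl k σ (g i)).coeff.support := by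
      rw [hg, Toric.mem_support_single_mul, zero_sub]
      exact (Toric.mem_support_initialForm.1 (hu' i _ hne)).1
    exact (Toric.mem_support_incl h1).2
  have hrad : I.IsRadical := by
    rw [Ideal.isRadical_iff_quotient_reduced]
    exact (AlgebraicGeometry.affine_isReduced_iff _).1 hred
  rw [Toric.closureIdeal_eq_comap hrad]
  have := Toric.isNoetherianRing_coordRing_hull (k := k) b s
  apply le_antisymm
  · rw [Ideal.span_le]
    rintro _ ⟨i, rfl⟩
    change Toric.incl k σ (g i) ∈ I
    rw [hg, hI]
    exact Ideal.mul_mem_left _ _ (Ideal.subset_span ⟨i, rfl⟩)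
  · intro h hh
    have hh' : Toric.incl k σ h ∈ I := hh
    rw [hI] at hh'
    exact (Toric.coneCoordinates b s).mem_span_range_of_incl_mem hg hg0 (hI ▸ hgen) hh'
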